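/- Let $k$ be an algebraically closed field (of any characteristic). A subset $E\subset\mathbb{A}^3_k$ is called Kakeya if it contains a line in every direction. Let $g\in k[x_1,x_2,x_3]$ be irreducible of degree $d\ge 3$, let $R_1,\dots,R_s\in V(g)$ be points, and suppose that $E=\{R_1,\dots,R_s\}\cup\{g\neq 0\}\subset\mathbb{A}^3_k$ is Kakeya. Let $G\in k[x_0,x_1,x_2,x_3]$ be the homogenization of $g$, let $C=V(G)\cap V(x_0)\subset\mathbb{P}^3$ be the curve at infinity, and let $F=G(0,x_1,x_2,x_3)$ be its equation in the plane $V(x_0)\simeq\mathbb{P}^2$. (1) $C$ is irreducible: it is an irreducible closed subset of $\mathbb{P}^3$, and the form $F$ is an irreducible polynomial. (2) $V(G)$ is a cone over $C$: there is a point $v\in\mathbb{P}^3$, $v\notin V(x_0)$, such that $V(G)$ is the union of the lines joining $v$ with the points of $C$. (3) If moreover $C=V(F)\subset\mathbb{P}^2$ is neither flexy nor funny, then $C$ has a unique singular point, and the multiplicity of $C$ at that point is $d-1$. Here the multiplicity of $C$ at a point $p$ is the least $m$ such that $f_m\ne 0$, where $f=f_0+f_1+f_2+\cdots$ is the expansion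 into homogeneous parts of an affine equation $f$ of $C$, in coordinates of an affine chart centred at $p$; a point of $C$ is smooth if its multiplicity is $1$ and singular otherwise. The curve $C$ is flexy if $f_1\mid f_2$ at every smooth point of $C$. It is funny if there is a point $p_0\in\mathbb{P}^2$ such that for all points $p\in C$, $p\neq p_0$, the line joining $p$ and $p_0$ is tangent to $C$ at $p$, that is, lies in $\{x : \sum_i \frac{\partial F}{\partial x_i}(p)\,x_i=0\}$. -/

import Mathlib

open MvPolynomial
open scoped LinearAlgebra.Projectivization

namespace KakeyaCone

noncomputable section

/-- A subset of affine `n`-space is Kakeya if it contains a line in every direction. -/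
def IsKakeya {k : Type*} [Field k] {n : ℕ} (E : Set (Fin n → k)) : Prop :=
  ∀ v : Fin n → k, v ≠ 0 → ∃ a : Fin n → k, ∀ t : k, a + t • v ∈ E

/-- The homogenization of `g` in the variables `x_0, x_1, …, x_n` (of degree `g.totalDegree`);
the affine variable with index `i` becomes the projective variable with index `i.succ`. -/
def homogenization {k : Type*} [Field k] {n : ℕ} (g : MvPolynomial (Fin n) k) :
    MvPolynomial (Fin (n + 1)) k :=
  ∑ i ∈ Finset.range (g.totalDegree + 1),
    X 0 ^ (g.totalDegree - i) * rename Fin.succ (homogeneousComponent i g)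

/-- The zero locus in projective space of a homogeneous polynomial `F`. -/
def projZeros {k : Type*} [Field k] {n : ℕ} (F : MvPolynomial (Fin n) k) :
    Set (ℙ k (Fin n → k)) :=
  {p | eval p.rep F = 0}

/-- For a form `F`, vanishing at a projective point does not depend on the representative. -/
theorem mem_projZeros_iff {k : Type*} [Field k] {n d : ℕ} {F : MvPolynomial (Fin n) k}
    (hF : F.IsHomogeneous d) (v : Fin n → k) (hv : v ≠ 0) :
    Projectivization.mk k v hv ∈ projZeros F ↔ eval v F = 0 := by
  obtain ⟨a, ha⟩ := Projectivization.exists_smul_eq_mk_rep k v hv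
  have h : eval (Projectivization.mk k v hv).rep F = (a : k) ^ d * eval v F := by
    rw [← ha]
    rw [eval_eq, eval_eq, Finset.mul_sum]
    refine Finset.sum_congr rfl fun m hm => ?_
    have hdeg : ∑ i ∈ m.support, m i = d := by
      have := hF (mem_support_iff.mp hm)
      simpa [Finsupp.weight_apply, Finsupp.sum] using this
    simp only [Units.smul_def, Pi.smul_apply, smul_eq_mul, mul_pow, Finset.prod_mul_distrib,
      Finset.prod_pow_eq_pow_sum, hdeg]
    ring
  simp [projZeros, h]

/-- Closed subsets of projective space in the Zariski topology. -/
def IsZariskiClosed {k : Type*} [Field k] {n : ℕ} (Z : Set (ℙ k (Fin n → k))) : Prop :=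
  ∃ S : Set (MvPolynomial (Fin n) k),
    (∀ F ∈ S, ∃ d : ℕ, F.IsHomogeneous d) ∧ Z = ⋂ F ∈ S, projZeros F

/-- Irreducibility of a subset of projective space in the Zariski topology. -/
def IsZariskiIrreducible {k : Type*} [Field k] {n : ℕ} (Z : Set (ℙ k (Fin n → k))) : Prop :=
  Z.Nonempty ∧ ∀ A B : Set (ℙ k (Fin n → k)), IsZariskiClosed A → IsZariskiClosed B →
    Z ⊆ A ∪ B → Z ⊆ A ∨ Z ⊆ B

/-- The hyperplane at infinity `V(x_0)` in projective `n`-space. -/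
def hyperplaneAtInfinity (k : Type*) [Field k] (n : ℕ) : Set (ℙ k (Fin (n + 1) → k)) :=
  projZeros (X 0)

/-- The curve at infinity (for `n = 3`) `V(G) ∩ V(x_0)`, where `G` is the homogenization of `g`,
as a subset of projective space. -/
def locusAtInfinity {k : Type*} [Field k] {n : ℕ} (g : MvPolynomial (Fin n) k) :
    Set (ℙ k (Fin (n + 1) → k)) :=
  projZeros (homogenization g) ∩ hyperplaneAtInfinity k n

/-- The form `G(0, x_1, …, x_n)`: the equation of `V(G) ∩ V(x_0)` in the projective space `V(x_0)`
with homogeneous coordinates `x_1, …, x_n`. -/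
def formAtInfinity {k : Type*} [Field k] {n : ℕ} (g : MvPolynomial (Fin n) k) :
    MvPolynomial (Fin n) k :=
  aeval (Fin.cons 0 X : Fin (n + 1) → MvPolynomial (Fin n) k) (homogenization g)

theorem homogenization_isHomogeneous {k : Type*} [Field k] {n : ℕ}
    (g : MvPolynomial (Fin n) k) : (homogenization g).IsHomogeneous g.totalDegree := by
  refine IsHomogeneous.sum _ _ _ fun i hi => ?_
  have h1 : ((X 0 : MvPolynomial (Fin (n + 1)) k) ^ (g.totalDegree - i)).IsHomogeneous
      (g.totalDegree - i) := by
    simpa using (isHomogeneous_X k (0 : Fin (n + 1))).pow (g.totalDegree - i)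
  have h2 := h1.mul ((homogeneousComponent_isHomogeneous i g).rename_isHomogeneous (f := Fin.succ))
  have hi' : g.totalDegree - i + i = g.totalDegree := by
    have := Finset.mem_range.mp hi
    omega
  rwa [hi'] at h2

/-- The form `G(0, x_1, …, x_n)` is the leading form of `g`. -/
theorem formAtInfinity_eq {k : Type*} [Field k] {n : ℕ} (g : MvPolynomial (Fin n) k) :
    formAtInfinity g = homogeneousComponent g.totalDegree g := by
  have h : ∀ i, aeval (Fin.cons 0 X : Fin (n + 1) → MvPolynomial (Fin n) k)
      (rename Fin.succ (homogeneousComponent i g)) = homogeneousComponent i g := by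
    intro i
    rw [aeval_rename]
    have : (Fin.cons 0 X : Fin (n + 1) → MvPolynomial (Fin n) k) ∘ Fin.succ = X := by
      funext j
      simp
    rw [this, aeval_X_left_apply]
  unfold formAtInfinity homogenization
  rw [map_sum, Finset.sum_eq_single g.totalDegree]
  · rw [map_mul, h]
    simp
  · intro i hi hne
    have : g.totalDegree - i ≠ 0 := by
      have := Finset.mem_range.mp hi
      omega
    simp [this]
  · simp

/-- Under the identification `[x_1 : … : x_n] ↦ [0 : x_1 : … : x_n]` of projective `(n-1)`-space
with `V(x_0)`, the zero locus of `G(0, x_1, …, x_n)` is `V(G) ∩ V(x_0)`. -/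
theorem mem_locusAtInfinity_iff {k : Type*} [Field k] {n : ℕ} (g : MvPolynomial (Fin n) k)
    (w : Fin n → k) (hw : w ≠ 0) (hw' : (Fin.cons 0 w : Fin (n + 1) → k) ≠ 0) :
    Projectivization.mk k (Fin.cons 0 w : Fin (n + 1) → k) hw' ∈ locusAtInfinity g ↔
      Projectivization.mk k w hw ∈ projZeros (formAtInfinity g) := by
  have hF : (formAtInfinity g).IsHomogeneous g.totalDegree := by
    rw [formAtInfinity_eq]
    exact homogeneousComponent_isHomogeneous _ _
  have he : eval w (formAtInfinity g) = eval (Fin.cons 0 w : Fin (n + 1) → k)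
      (homogenization g) := by
    have hc : (fun j => eval w ((Fin.cons 0 X : Fin (n + 1) → MvPolynomial (Fin n) k) j)) =
        (Fin.cons 0 w : Fin (n + 1) → k) := by
      funext j
      refine Fin.cases ?_ (fun j => ?_) j <;> simp
    rw [← hc]
    unfold formAtInfinity
    generalize homogenization g = F
    induction F using MvPolynomial.induction_on with
    | C a => simp
    | add p q hp hq => rw [map_add, map_add, map_add, hp, hq]
    | mul_X p i hp => rw [map_mul, map_mul, map_mul, hp, aeval_X, eval_X]
  rw [locusAtInfinity, Set.mem_inter_iff, mem_projZeros_iff (homogenization_isHomogeneous g),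
    hyperplaneAtInfinity, mem_projZeros_iff (isHomogeneous_X k 0), mem_projZeros_iff hF, he]
  simp

/-- The cone with vertex `v` over `Z`: the union of the lines that join `v` with points of `Z`. -/
def cone {k : Type*} [Field k] {n : ℕ} (v : ℙ k (Fin n → k)) (Z : Set (ℙ k (Fin n → k))) :
    Set (ℙ k (Fin n → k)) :=
  {r | ∃ q ∈ Z, r.submodule ≤ v.submodule ⊔ q.submodule}

/-- The polynomial `f(x + a)`. -/
def translate {k : Type*} [Field k] {σ : Type*} (f : MvPolynomial σ k) (a : σ → k) :
    MvPolynomial σ k :=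
  aeval (fun i => X i + C (a i)) f

/-- `f` vanishes at `a` with multiplicity `m`: the polynomial `f(x + a)` has no terms of degree
less than `m` and has nonzero terms of degree `m`. -/
def VanishesWithMult {k : Type*} [Field k] {σ : Type*} (f : MvPolynomial σ k) (a : σ → k)
    (m : ℕ) : Prop :=
  (∀ i < m, homogeneousComponent i (translate f a) = 0) ∧
    homogeneousComponent m (translate f a) ≠ 0

/-- The dehomogenization of a form with respect to its variable `x_i`. -/
def dehomog {k : Type*} [Field k] {n : ℕ} (i : Fin (n + 1)) (F : MvPolynomial (Fin (n + 1)) k) :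
    MvPolynomial (Fin n) k :=
  aeval (Fin.insertNth i 1 X : Fin (n + 1) → MvPolynomial (Fin n) k) F

/-- The affine coordinates of a projective point `p` in the chart `x_i ≠ 0`
(used only when `x_i ≠ 0` at `p`). -/
def chart {k : Type*} [Field k] {n : ℕ} (i : Fin (n + 1)) (p : ℙ k (Fin (n + 1) → k)) :
    Fin n → k :=
  fun j => p.rep (i.succAbove j) / p.rep i

/-- The hypersurface `V(F)` has multiplicity `m` at `p`, computed in the standard affine charts
around `p`. -/
def HasMult {k : Type*} [Field k] {n : ℕ} (F : MvPolynomial (Fin (n + 1)) k)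
    (p : ℙ k (Fin (n + 1) → k)) (m : ℕ) : Prop :=
  ∀ i, p.rep i ≠ 0 → VanishesWithMult (dehomog i F) (chart i p) m

/-- `p` is a smooth point of the hypersurface `V(F)`. -/
def IsSmoothPt {k : Type*} [Field k] {n : ℕ} (F : MvPolynomial (Fin (n + 1)) k)
    (p : ℙ k (Fin (n + 1) → k)) : Prop :=
  p ∈ projZeros F ∧ HasMult F p 1

/-- `p` is a singular point of the hypersurface `V(F)`. -/
def IsSingularPt {k : Type*} [Field k] {n : ℕ} (F : MvPolynomial (Fin (n + 1)) k)
    (p : ℙ k (Fin (n + 1) → k)) : Prop :=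
  p ∈ projZeros F ∧ ¬ HasMult F p 1

/-- With `f = f_1 + f_2 + …` the expansion of an affine equation around a (smooth) point `p` of
`V(F)`, the point is flexy if `f_1` divides `f_2`. -/
def IsFlexyPt {k : Type*} [Field k] {n : ℕ} (F : MvPolynomial (Fin (n + 1)) k)
    (p : ℙ k (Fin (n + 1) → k)) : Prop :=
  ∀ i, p.rep i ≠ 0 →
    homogeneousComponent 1 (translate (dehomog i F) (chart i p)) ∣
      homogeneousComponent 2 (translate (dehomog i F) (chart i p))

/-- The plane curve `V(F)` is flexy if all its smooth points are flexy. -/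
def IsFlexy {k : Type*} [Field k] (F : MvPolynomial (Fin 3) k) : Prop :=
  ∀ p : ℙ k (Fin 3 → k), IsSmoothPt F p → IsFlexyPt F p

/-- For `p` on the plane curve `V(F)` and `q ≠ p`: the line joining `p` and `q` is tangent to
`V(F)` at `p`, that is, it lies in the projective tangent space
`{x | ∑ i, (∂F/∂x_i)(p) x_i = 0}` (so every line through a singular point counts as tangent
there). -/
def JoinIsTangent {k : Type*} [Field k] (F : MvPolynomial (Fin 3) k)
    (p q : ℙ k (Fin 3 → k)) : Prop :=
  ∑ i, eval p.rep (pderiv i F) * q.rep i = 0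

/-- The plane curve `V(F)` is funny if for some point `q` of the plane, for all points `p` of the
curve (other than `q`), the line joining `p` and `q` is tangent to the curve at `p`. -/
def IsFunny {k : Type*} [Field k] (F : MvPolynomial (Fin 3) k) : Prop :=
  ∃ q : ℙ k (Fin 3 → k), ∀ p ∈ projZeros F, p ≠ q → JoinIsTangent F p q

end

end KakeyaCone

namespace KakeyaCone

noncomputable section

/-! A Kakeya line in direction v meets V(g) only in points R_i. For general v it contains at most
one R_i, and g has degree d on it because F(v) ≠ 0. So g has a root there and, expanded at that R_i,
is a monomial c T^d; every part of g(R_i + x) of degree < d then vanishes at v. If each R_i had a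
nonzero part of degree < d, a v off all of these would give a contradiction. Hence g(R_i + x) = F(x)
for some i (`exists_vertex`). This makes F irreducible and V(G) a cone, which gives (1) and (2).

For (3), move that vertex to the origin: now F has such lines, with points r_j = R_j - R_i. Take
directions p with F(p) = 0. Then F(r_j + T p) has no T^d term, and its T^(d-1) coefficient is
∇F(p)·r_j, which for r_j ≠ 0 is not identically zero on C because C is not funny. If the line for a
general p passes through r_j, the restriction is a monomial, so all parts of degree < d - 1 at r_j
vanish at p; but a nonzero form of degree < d cannot vanish on all of C. If instead the line misses
V(F), then F is c t^d on the plane spanned by p and the line, so p is a flex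
(`eval_flexForm_eq_zero`); this fails for general p, as C is not flexy. So some r_j ≠ 0 has
multiplicity at least d - 1 (`exists_vanishing_to_order`), and exactly d - 1 since C is not funny. A
second singular point would force the joining line into C (`exists_unique_singularPt`). -/

/-- The univariate polynomial `F(p + T y)`. -/
def lineP {R : Type*} [CommRing R] {k : Type*} [CommRing k] [Algebra k R] {σ : Type*}
    (F : MvPolynomial σ k) (p y : σ → R) : Polynomial R :=
  aeval (fun i => Polynomial.C (p i) + Polynomial.X * Polynomial.C (y i)) F

/-! ### Expansions along lines, and divisibility by an irreducible polynomial. -/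

section Line

variable {k : Type*} [Field k] {σ : Type*}

theorem eval_lineP (F : MvPolynomial σ k) (p y : σ → k) (t : k) :
    (lineP F p y).eval t = eval (p + t • y) F := by
  induction F using MvPolynomial.induction_on with
  | C a => simp [lineP]
  | add f g hf hg => simp only [lineP, map_add, Polynomial.eval_add] at *; rw [hf, hg]
  | mul_X f i hf => simp only [lineP, map_mul, Polynomial.eval_mul] at *; rw [hf]; simp [mul_comm t]

/-- Coefficients of `F(X + T Y)` for polynomial vectors specialize to those at points. -/
theorem eval_coeff_lineP {τ : Type*} (F : MvPolynomial σ k) (u w : σ → MvPolynomial τ k)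
    (q : τ → k) (j : ℕ) :
    eval q ((lineP F u w).coeff j) =
      (lineP F (fun i => eval q (u i)) (fun i => eval q (w i))).coeff j := by
  rw [← Polynomial.coeff_map]
  congr 1
  induction F using MvPolynomial.induction_on with
  | C a => simp [lineP, IsScalarTower.algebraMap_apply k (MvPolynomial τ k)
      (Polynomial (MvPolynomial τ k)), MvPolynomial.algebraMap_eq]
  | add f g hf hg => simp only [lineP, map_add, Polynomial.map_add] at *; rw [hf, hg]
  | mul_X f i hf => simp only [lineP, map_mul, Polynomial.map_mul] at *; rw [hf]; simp

theorem natDegree_lineP_le (F : MvPolynomial σ k) (p y : σ → k) :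
    (lineP F p y).natDegree ≤ F.totalDegree := by
  have h : ∀ i, (Polynomial.C (p i) + Polynomial.X * Polynomial.C (y i)).natDegree ≤ 1 := by
    intro i
    compute_degree
  simpa [lineP] using MvPolynomial.aeval_natDegree_le (m := F.totalDegree) (n := 1) F le_rfl
    (fun i => Polynomial.C (p i) + Polynomial.X * Polynomial.C (y i)) h

theorem eval_smul_of_isHomogeneous {F : MvPolynomial σ k} {d : ℕ}
    (hF : F.IsHomogeneous d) (c : k) (x : σ → k) : eval (c • x) F = c ^ d * eval x F := by
  rw [eval_eq, eval_eq, Finset.mul_sum]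
  refine Finset.sum_congr rfl fun m hm => ?_
  have hdeg : ∑ i ∈ m.support, m i = d := by
    have := hF (mem_support_iff.mp hm)
    simpa [Finsupp.weight_apply, Finsupp.sum] using this
  simp only [Pi.smul_apply, smul_eq_mul, mul_pow, Finset.prod_mul_distrib,
    Finset.prod_pow_eq_pow_sum, hdeg]
  ring

theorem eval_translate (F : MvPolynomial σ k) (p y : σ → k) :
    eval y (translate F p) = eval (p + y) F := by
  induction F using MvPolynomial.induction_on with
  | C a => simp [translate]
  | add f g hf hg => simp only [translate, map_add] at *; rw [hf, hg]
  | mul_X f i hf => simp only [translate, map_mul] at *; rw [hf]; simp [add_comm]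

theorem poly_ext_of_eval_ne_zero [Infinite k] {f g : Polynomial k}
    (h : ∀ t : k, t ≠ 0 → f.eval t = g.eval t) : f = g := by
  refine Polynomial.eq_of_infinite_eval_eq f g ?_
  refine Set.Infinite.mono (s := {0}ᶜ) (fun t ht => h t ht) ?_
  exact (Set.finite_singleton (0 : k)).infinite_compl

theorem coeff_lineP [Infinite k] (F : MvPolynomial σ k) (p y : σ → k) (j : ℕ) :
    (lineP F p y).coeff j = eval y (homogeneousComponent j (translate F p)) := by
  have h : lineP F p y = ∑ i ∈ Finset.range ((translate F p).totalDegree + 1),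
      Polynomial.C (eval y (homogeneousComponent i (translate F p))) * Polynomial.X ^ i := by
    refine poly_ext_of_eval_ne_zero fun t _ => ?_
    rw [eval_lineP, ← eval_translate]
    conv_lhs => rw [← sum_homogeneousComponent (translate F p)]
    rw [map_sum, Polynomial.eval_finsetSum]
    refine Finset.sum_congr rfl fun i _ => ?_
    rw [eval_smul_of_isHomogeneous (homogeneousComponent_isHomogeneous i _)]
    rw [Polynomial.eval_mul, Polynomial.eval_C, Polynomial.eval_pow, Polynomial.eval_X, mul_comm]
  rw [h, Polynomial.finsetSum_coeff]
  simp only [Polynomial.coeff_C_mul_X_pow]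
  rw [Finset.sum_ite_eq]
  split_ifs with hj
  · rfl
  · rw [homogeneousComponent_eq_zero, map_zero]
    simpa using hj

theorem coeff_lineP_smul [Infinite k] (F : MvPolynomial σ k) (p y : σ → k) (c : k) (j : ℕ) :
    (lineP F p (c • y)).coeff j = c ^ j * (lineP F p y).coeff j := by
  rw [coeff_lineP, coeff_lineP,
    eval_smul_of_isHomogeneous (homogeneousComponent_isHomogeneous j _)]

theorem reflect_lineP [Infinite k] {F : MvPolynomial σ k} {d : ℕ} (hF : F.IsHomogeneous d)
    (p y : σ → k) : Polynomial.reflect d (lineP F p y) = lineP F y p := by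
  refine poly_ext_of_eval_ne_zero fun t ht => ?_
  let _ : Invertible t⁻¹ := invertibleOfNonzero (inv_ne_zero ht)
  have h := Polynomial.eval₂_reflect_mul_pow (RingHom.id k) t⁻¹ d (lineP F p y)
    ((natDegree_lineP_le F p y).trans hF.totalDegree_le)
  rw [← Polynomial.eval, ← Polynomial.eval, eval_lineP, invOf_eq_inv, inv_inv] at h
  have h2 : y + t • p = t • (p + t⁻¹ • y) := by
    rw [smul_add, smul_smul, mul_inv_cancel₀ ht, one_smul, add_comm]
  rw [eval_lineP, h2, eval_smul_of_isHomogeneous hF, ← h, mul_left_comm, ← mul_pow,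
    mul_inv_cancel₀ ht, one_pow, mul_one]

/-- For T ≠ 0, F(p + T y) = T^d F(y + T⁻¹ p), which reverses the coefficients. The case j = 1 is
polarity: the part of degree d - 1 at r vanishes at p exactly when r lies in the tangent plane at p.
-/
theorem coeff_lineP_comm [Infinite k] {F : MvPolynomial σ k} {d : ℕ} (hF : F.IsHomogeneous d)
    (p y : σ → k) {j : ℕ} (hj : j ≤ d) :
    (lineP F p y).coeff (d - j) = (lineP F y p).coeff j := by
  rw [← reflect_lineP hF p y, Polynomial.coeff_reflect, Polynomial.revAt_le hj]

theorem coeff_zero_lineP (F : MvPolynomial σ k) (p y : σ → k) :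
    (lineP F p y).coeff 0 = eval p F := by
  rw [Polynomial.coeff_zero_eq_eval_zero, eval_lineP, zero_smul, add_zero]

theorem coeff_one_lineP [Fintype σ] [DecidableEq σ] (F : MvPolynomial σ k) (p y : σ → k) :
    (lineP F p y).coeff 1 = ∑ i, eval p (pderiv i F) * y i := by
  induction F using MvPolynomial.induction_on with
  | C a => simp [lineP]
  | add f g hf hg =>
    simp only [lineP, map_add, Polynomial.coeff_add] at *
    rw [hf, hg, ← Finset.sum_add_distrib]
    simp [add_mul]
  | mul_X f i hf =>
    have h0 := coeff_zero_lineP f p y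
    simp only [lineP, map_mul] at *
    rw [Polynomial.mul_coeff_one, hf, h0]
    simp only [aeval_X, Polynomial.coeff_add, Derivation.leibniz, pderiv_X, smul_eq_mul, map_add,
      map_mul, eval_X, add_mul, Finset.sum_add_distrib]
    simp only [Pi.single_apply, Polynomial.coeff_C_zero, Polynomial.coeff_C_succ, Finset.sum_mul,
      Polynomial.coeff_X_mul_zero, Polynomial.coeff_X_mul]
    simp
    exact Finset.sum_congr rfl fun _ _ => by ring

theorem coeff_natDegree_lineP [Infinite k] {F : MvPolynomial σ k} {d : ℕ}
    (hF : F.IsHomogeneous d) (p y : σ → k) : (lineP F p y).coeff d = eval y F := by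
  have := coeff_lineP_comm hF p y (Nat.zero_le d)
  rwa [Nat.sub_zero, coeff_zero_lineP] at this

/-- The polynomial splits and 0 is its only possible root. A line with at most one zero thus gives a
restriction with at most one nonzero coefficient. -/
theorem exists_eq_C_mul_X_pow [IsAlgClosed k] {f : Polynomial k}
    (hf : ∀ t, f.eval t = 0 → t = 0) :
    ∃ (c : k) (m : ℕ), f = Polynomial.C c * Polynomial.X ^ m := by
  have h := (IsAlgClosed.splits f).eq_prod_roots
  have h2 : f.roots = Multiset.replicate (Multiset.card f.roots) 0 :=
    Multiset.eq_replicate_card.2 fun t ht => hf t (Polynomial.isRoot_of_mem_roots ht)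
  refine ⟨f.leadingCoeff, Multiset.card f.roots, ?_⟩
  rw [h2] at h
  simpa using h

/-- Vanishing of a polynomial on an irreducible hypersurface implies divisibility. -/
theorem dvd_of_vanishes [IsAlgClosed k] [Finite σ] {F P : MvPolynomial σ k} (hF : Irreducible F)
    (h : ∀ x, eval x F = 0 → eval x P = 0) : F ∣ P := by
  have hp : (Ideal.span {F}).IsPrime :=
    (Ideal.span_singleton_prime hF.ne_zero).2 hF.prime
  have h1 : P ∈ vanishingIdeal k (zeroLocus k (Ideal.span {F})) := by
    intro x hx
    have := hx F (Ideal.mem_span_singleton_self F)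
    rw [aeval_eq_eval] at this ⊢
    exact h x this
  rw [vanishingIdeal_zeroLocus_eq_radical, hp.radical] at h1
  exact Ideal.mem_span_singleton.1 h1

/-- The general-position device on V(F): P is a product of finitely many conditions, none divisible
by the prime F. -/
theorem exists_zero_of_not_dvd [IsAlgClosed k] [Finite σ] {F P : MvPolynomial σ k}
    (hF : Irreducible F) (h : ¬ F ∣ P) : ∃ x, eval x F = 0 ∧ eval x P ≠ 0 := by
  contrapose! h
  exact dvd_of_vanishes hF h

theorem not_dvd_of_isHomogeneous_lt {F P : MvPolynomial σ k} {d e : ℕ} (hF0 : F ≠ 0)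
    (hF : F.IsHomogeneous d) (hP : P.IsHomogeneous e) (hP0 : P ≠ 0) (h : e < d) : ¬ F ∣ P := by
  intro hd
  have := totalDegree_le_of_dvd_of_isDomain hd hP0
  rw [hF.totalDegree hF0, hP.totalDegree hP0] at this
  omega

theorem exists_eval_ne_zero [Infinite k] {P : MvPolynomial σ k} (h : P ≠ 0) :
    ∃ x, eval x P ≠ 0 := by
  contrapose! h
  exact MvPolynomial.funext fun x => by simpa using h x

end Line

/-! ### Linear forms. -/

/-- A linear form with coefficients `c`. -/
def linForm {k : Type*} [Field k] {n : ℕ} (c : Fin n → k) : MvPolynomial (Fin n) k :=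
  ∑ i, C (c i) * X i

theorem eval_linForm {k : Type*} [Field k] {n : ℕ} (c x : Fin n → k) :
    eval x (linForm c) = ∑ i, c i * x i := by
  simp [linForm]

theorem linForm_isHomogeneous {k : Type*} [Field k] {n : ℕ} (c : Fin n → k) :
    (linForm c).IsHomogeneous 1 :=
  IsHomogeneous.sum _ _ _ fun i _ => by
    simpa using (isHomogeneous_C _ (c i)).mul (isHomogeneous_X k i)

theorem linForm_ne_zero {k : Type*} [Field k] {n : ℕ} {c : Fin n → k} (hc : c ≠ 0) :
    linForm c ≠ 0 := by
  obtain ⟨i, hi⟩ := Function.ne_iff.1 hc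
  intro h
  have := eval_linForm c (Pi.single i 1)
  rw [h] at this
  exact hi (by simpa [Pi.single_apply] using this.symm)

theorem irreducible_linForm {k : Type*} [Field k] {n : ℕ} {c : Fin n → k} (hc : c ≠ 0) :
    Irreducible (linForm c) := by
  have hd := (linForm_isHomogeneous c).totalDegree (linForm_ne_zero hc)
  refine irreducible_of_totalDegree_eq_one hd fun x hx => ?_
  refine isUnit_iff_ne_zero.2 ?_
  rintro rfl
  refine linForm_ne_zero hc (MvPolynomial.ext _ _ fun m => ?_)
  simpa using hx m

/-- For every vector there is a nonzero linear form that vanishes there. -/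
theorem exists_linForm_vanishing {k : Type*} [Field k] (w : Fin 3 → k) :
    ∃ c : Fin 3 → k, c ≠ 0 ∧ ∑ i, c i * w i = 0 := by
  by_cases h : w 0 = 0
  · refine ⟨![1, 0, 0], fun h1 => by simpa using congrFun h1 0, by simp [Fin.sum_univ_three, h]⟩
  · refine ⟨![w 1, -w 0, 0], fun h1 => h ?_, ?_⟩
    · simpa using congrFun h1 1
    · simp [Fin.sum_univ_three]; ring

/-! ### Substitution and homogenization. -/

section Substitution

variable {k : Type*} [Field k]

theorem eval_aeval_eq {σ τ : Type*} (f : σ → MvPolynomial τ k) (x : τ → k)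
    (P : MvPolynomial σ k) : eval x (aeval f P) = eval (fun i => eval x (f i)) P := by
  induction P using MvPolynomial.induction_on with
  | C a => simp
  | add p q hp hq => rw [map_add, map_add, map_add, hp, hq]
  | mul_X p i hp => rw [map_mul, map_mul, map_mul, hp, aeval_X, eval_X]

theorem eval_formAtInfinity {n : ℕ} (g : MvPolynomial (Fin n) k) (w : Fin n → k) :
    eval w (formAtInfinity g) = eval (Fin.cons 0 w : Fin (n + 1) → k) (homogenization g) := by
  have hc : (fun j => eval w ((Fin.cons 0 X : Fin (n + 1) → MvPolynomial (Fin n) k) j)) =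
      (Fin.cons 0 w : Fin (n + 1) → k) := by
    funext j
    refine Fin.cases ?_ (fun j => ?_) j <;> simp
  rw [formAtInfinity, eval_aeval_eq, hc]

theorem eval_aeval_insertNth {n : ℕ} (i : Fin (n + 1)) (c : k) (y : Fin n → k)
    (P : MvPolynomial (Fin (n + 1)) k) :
    eval y (aeval (Fin.insertNth i (C c) X : Fin (n + 1) → MvPolynomial (Fin n) k) P) =
      eval (Fin.insertNth i c y : Fin (n + 1) → k) P := by
  rw [eval_aeval_eq]
  congr 2
  funext j
  refine Fin.succAboveCases i ?_ (fun j => ?_) j <;> simp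

theorem formAtInfinity_isHomogeneous {n : ℕ} (g : MvPolynomial (Fin n) k) :
    (formAtInfinity g).IsHomogeneous g.totalDegree := by
  rw [formAtInfinity_eq]
  exact homogeneousComponent_isHomogeneous _ _

theorem eval_cons_one_homogenization {n : ℕ} (g : MvPolynomial (Fin n) k) (x : Fin n → k) :
    eval (Fin.cons 1 x : Fin (n + 1) → k) (homogenization g) = eval x g := by
  have hc : (Fin.cons 1 x : Fin (n + 1) → k) ∘ Fin.succ = x := by
    funext j
    simp
  conv_rhs => rw [← sum_homogeneousComponent g]
  simp [homogenization, eval_rename, hc]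

theorem coeff_totalDegree_lineP [Infinite k] {n : ℕ} (g : MvPolynomial (Fin n) k)
    (p y : Fin n → k) :
    (lineP g p y).coeff g.totalDegree = eval y (formAtInfinity g) := by
  have h : lineP g p y = lineP (homogenization g) (Fin.cons 1 p : Fin (n + 1) → k)
      (Fin.cons 0 y : Fin (n + 1) → k) := by
    refine poly_ext_of_eval_ne_zero fun t _ => ?_
    rw [eval_lineP, eval_lineP, ← eval_cons_one_homogenization]
    congr 2
    funext j
    refine Fin.cases ?_ (fun j => ?_) j <;> simp
  rw [h, coeff_natDegree_lineP (homogenization_isHomogeneous g), eval_formAtInfinity]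

end Substitution

/-! ### The vertex of the cone. -/

section Vertex

variable {k : Type*} [Field k]

/-- Two points of a finite set are never joined by a line in a direction `v` where the product of
these linear forms does not vanish. -/
theorem exists_separating_forms [IsAlgClosed k] {s : ℕ} (R : Fin s → Fin 3 → k) :
    ∃ c : Fin s → Fin s → Fin 3 → k, (∀ i l, c i l ≠ 0) ∧
      ∀ v, eval v (∏ i, ∏ l, linForm (c i l)) ≠ 0 → ∀ i l (t : k), R i + t • v = R l → t = 0 := by
  choose c hc hc' using fun i l => exists_linForm_vanishing (R l - R i)
  refine ⟨c, hc, fun v hv i l t ht => ?_⟩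
  have h1 : eval v (linForm (c i l)) ≠ 0 := by
    rw [eval_prod, Finset.prod_ne_zero_iff] at hv
    have := hv i (Finset.mem_univ _)
    rw [eval_prod, Finset.prod_ne_zero_iff] at this
    exact this l (Finset.mem_univ _)
  have h2 := hc' i l
  rw [← ht, add_sub_cancel_left, ← eval_linForm,
    eval_smul_of_isHomogeneous (linForm_isHomogeneous _), pow_one] at h2
  exact (mul_eq_zero.1 h2).resolve_right h1

theorem eq_zero_of_mem_line {s : ℕ} {R : Fin s → Fin 3 → k} {g : MvPolynomial (Fin 3) k}
    {v a : Fin 3 → k} (hv : ∀ i l (t : k), R i + t • v = R l → t = 0)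
    (ha : ∀ t : k, eval (a + t • v) g = 0 → a + t • v ∈ Set.range R)
    {i : Fin s} {t₀ : k} (hi : R i = a + t₀ • v) (t : k) (ht : eval (R i + t • v) g = 0) :
    t = 0 := by
  have h : R i + t • v = a + (t₀ + t) • v := by rw [hi, add_smul, add_assoc]
  rw [h] at ht
  obtain ⟨l, hl⟩ := ha _ ht
  exact hv i l t (h.trans hl.symm)

theorem IsKakeya.exists_line {n s : ℕ} {R : Fin s → Fin n → k} {g : MvPolynomial (Fin n) k}
    (hE : IsKakeya (Set.range R ∪ {x | eval x g ≠ 0})) (v : Fin n → k) (hv : v ≠ 0) :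
    ∃ a : Fin n → k, ∀ t : k, eval (a + t • v) g = 0 → a + t • v ∈ Set.range R := by
  obtain ⟨a, ha⟩ := hE v hv
  exact ⟨a, fun t ht => (ha t).resolve_right fun h => h ht⟩

/-- A surface whose complement together with finitely many points of the surface is Kakeya is a
cone with vertex at one of these points. -/
theorem exists_vertex [IsAlgClosed k] {g : MvPolynomial (Fin 3) k} (hd : 0 < g.totalDegree) {s : ℕ}
    {R : Fin s → Fin 3 → k} (hE : IsKakeya (Set.range R ∪ {x | eval x g ≠ 0})) :
    ∃ i, ∀ x, eval (R i + x) g = eval x (formAtInfinity g) := by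
  have hF : formAtInfinity g ≠ 0 := by
    intro h
    have hg : homogeneousComponent g.totalDegree g = 0 := by rw [← formAtInfinity_eq, h]
    have h0 : g ≠ 0 := by rintro rfl; simp at hd
    obtain ⟨m, hm, hm'⟩ := Finset.exists_mem_eq_sup g.support (support_nonempty.2 h0)
      (fun m => m.sum fun _ e => e)
    have := congrArg (coeff m) hg
    rw [coeff_homogeneousComponent, if_pos, coeff_zero] at this
    · exact mem_support_iff.1 hm this
    · rw [totalDegree, hm']
      rfl
  obtain ⟨c, hc, hsep⟩ := exists_separating_forms R
  have key : ∃ i, ∀ j < g.totalDegree, homogeneousComponent j (translate g (R i)) = 0 := by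
    by_contra! hcon
    choose j hj hj' using hcon
    -- The factors provide, in order: v ≠ 0, degree d on the line, a nonvanishing low-degree part at
    -- each `R i`, and at most one point `R i` on the line.
    have hP : X 0 * formAtInfinity g * (∏ i, homogeneousComponent (j i) (translate g (R i))) *
        ∏ i, ∏ l, linForm (c i l) ≠ 0 :=
      mul_ne_zero (mul_ne_zero (mul_ne_zero (X_ne_zero _) hF)
        (Finset.prod_ne_zero_iff.2 fun i _ => hj' i)) (Finset.prod_ne_zero_iff.2 fun i _ =>
          Finset.prod_ne_zero_iff.2 fun l _ => linForm_ne_zero (hc i l))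
    obtain ⟨v, hv⟩ := exists_eval_ne_zero hP
    rw [map_mul, map_mul, map_mul] at hv
    have hv1 := right_ne_zero_of_mul hv
    have hv2 := right_ne_zero_of_mul (left_ne_zero_of_mul hv)
    have hv3 := right_ne_zero_of_mul (left_ne_zero_of_mul (left_ne_zero_of_mul hv))
    have hv4 := left_ne_zero_of_mul (left_ne_zero_of_mul (left_ne_zero_of_mul hv))
    have hv0 : v ≠ 0 := by
      rintro rfl
      simp at hv4
    obtain ⟨a, ha⟩ := hE.exists_line v hv0
    have hco := coeff_totalDegree_lineP g a v
    obtain ⟨t₀, ht₀⟩ := IsAlgClosed.exists_root (lineP g a v) (fun h0 => by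
      rw [Polynomial.eq_C_of_degree_eq_zero h0, Polynomial.coeff_C, if_neg hd.ne'] at hco
      exact hv3 hco.symm)
    rw [Polynomial.IsRoot, eval_lineP] at ht₀
    obtain ⟨i, hi⟩ := ha t₀ ht₀
    obtain ⟨e, m, hem⟩ := exists_eq_C_mul_X_pow (f := lineP g (R i) v) fun t ht =>
      eq_zero_of_mem_line (hsep v hv1) ha hi t (by rwa [eval_lineP] at ht)
    -- A monomial cannot have nonzero coefficients in both degrees `g.totalDegree` and `j i`.
    have h1 := coeff_totalDegree_lineP g (R i) v
    have h2 := coeff_lineP g (R i) v (j i)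
    rw [hem, Polynomial.coeff_C_mul_X_pow] at h1 h2
    rw [eval_prod, Finset.prod_ne_zero_iff] at hv2
    have hv2' := hv2 i (Finset.mem_univ _)
    have := hj i
    split_ifs at h1 h2
    · omega
    · exact hv2' h2.symm
    · exact hv3 h1.symm
    · exact hv3 h1.symm
  obtain ⟨i, hi⟩ := key
  refine ⟨i, fun x => ?_⟩
  have h : lineP g (R i) x =
      Polynomial.C (eval x (formAtInfinity g)) * Polynomial.X ^ g.totalDegree := by
    ext j
    rw [Polynomial.coeff_C_mul_X_pow]
    split_ifs with hj
    · rw [hj, coeff_totalDegree_lineP]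
    · rcases lt_or_gt_of_ne hj with hj | hj
      · rw [coeff_lineP, hi j hj, map_zero]
      · exact Polynomial.coeff_eq_zero_of_natDegree_lt ((natDegree_lineP_le _ _ _).trans_lt hj)
  have := congrArg (Polynomial.eval 1) h
  rw [eval_lineP] at this
  simpa using this

theorem irreducible_translate {σ : Type*} {g : MvPolynomial σ k} (hg : Irreducible g)
    (a : σ → k) : Irreducible (translate g a) := by
  have h : ∀ a b : σ → k, a + b = 0 →
      (aeval (fun i => X i + C (a i)) : MvPolynomial σ k →ₐ[k] MvPolynomial σ k).comp
        (aeval fun i => X i + C (b i)) = AlgHom.id k _ := by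
    intro a b hab
    ext1 i
    have := congrFun hab i
    simp only [Pi.add_apply, Pi.zero_apply] at this
    simp [add_assoc, ← C_add, this]
  have := (MulEquiv.irreducible_iff (AlgEquiv.ofAlgHom _ _ (h a (-a) (by simp))
    (h (-a) a (by simp)))).2 hg
  exact this

theorem irreducible_of_forall_eval_add [Infinite k] {σ : Type*} {g F : MvPolynomial σ k}
    (hg : Irreducible g) (a : σ → k) (h : ∀ x, eval (a + x) g = eval x F) : Irreducible F := by
  have : F = translate g a := MvPolynomial.funext fun x => by rw [eval_translate, h]
  rw [this]
  exact irreducible_translate hg a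

/-- Exhibits V(G) as the pullback of V(F) under projection from [1 : a], hence as a cone. -/
theorem eval_homogenization_of_vertex {n : ℕ} {g : MvPolynomial (Fin n) k} {a : Fin n → k}
    (h : ∀ x, eval (a + x) g = eval x (formAtInfinity g)) (x₀ : k) (x : Fin n → k) :
    eval (Fin.cons x₀ x : Fin (n + 1) → k) (homogenization g) =
      eval (x - x₀ • a) (formAtInfinity g) := by
  by_cases hx : x₀ = 0
  · rw [hx, zero_smul, sub_zero, eval_formAtInfinity]
  · have h1 : (Fin.cons x₀ x : Fin (n + 1) → k) = x₀ • Fin.cons 1 (x₀⁻¹ • x) := by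
      funext j
      refine Fin.cases ?_ (fun j => ?_) j <;> simp [hx]
    have h2 : x - x₀ • a = x₀ • (x₀⁻¹ • x - a) := by
      rw [smul_sub, smul_smul, mul_inv_cancel₀ hx, one_smul]
    rw [h1, h2, eval_smul_of_isHomogeneous (homogenization_isHomogeneous g),
      eval_smul_of_isHomogeneous (formAtInfinity_isHomogeneous g), eval_cons_one_homogenization,
      ← h, add_sub_cancel]

end Vertex

/-! ### The curve at infinity and the cone over it. -/

section AtInfinity

variable {k : Type*} [Field k]

theorem exists_ne_zero_zero [IsAlgClosed k] {F : MvPolynomial (Fin 3) k} {d : ℕ} (hd : 2 ≤ d)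
    (hF : F.IsHomogeneous d) (hirr : Irreducible F) : ∃ w, w ≠ 0 ∧ eval w F = 0 := by
  obtain ⟨w, hw, hw'⟩ := exists_zero_of_not_dvd hirr
    (not_dvd_of_isHomogeneous_lt hirr.ne_zero hF (isHomogeneous_X k 0) (X_ne_zero 0) hd)
  refine ⟨w, ?_, hw⟩
  rintro rfl
  simp at hw'

theorem cons_zero_ne_zero {n : ℕ} {w : Fin n → k} (hw : w ≠ 0) :
    (Fin.cons 0 w : Fin (n + 1) → k) ≠ 0 := by
  intro h
  refine hw (funext fun j => ?_)
  simpa using congrFun h j.succ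

theorem exists_eq_mk_of_mem_locusAtInfinity {n : ℕ} {g : MvPolynomial (Fin n) k}
    {q : ℙ k (Fin (n + 1) → k)} (hq : q ∈ locusAtInfinity g) :
    ∃ (w : Fin n → k) (hw : w ≠ 0), q = Projectivization.mk k _ (cons_zero_ne_zero hw) ∧
      eval w (formAtInfinity g) = 0 := by
  have h0 : q.rep 0 = 0 := by simpa [hyperplaneAtInfinity, projZeros] using hq.2
  have h1 : q.rep = Fin.cons 0 (Fin.tail q.rep) := by
    rw [← h0, Fin.cons_self_tail]
  have h2 : Fin.tail q.rep ≠ 0 := by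
    intro h
    refine q.rep_nonzero ?_
    rw [h1, h]
    funext j
    refine Fin.cases ?_ (fun j => ?_) j <;> simp
  refine ⟨Fin.tail q.rep, h2, ?_, ?_⟩
  · conv_lhs => rw [← q.mk_rep]
    congr 1
  · rw [eval_formAtInfinity, ← h1]
    exact hq.1

theorem mk_cons_zero_mem_locusAtInfinity {n : ℕ} {g : MvPolynomial (Fin n) k} {w : Fin n → k}
    (hw : w ≠ 0) (h : eval w (formAtInfinity g) = 0) :
    Projectivization.mk k _ (cons_zero_ne_zero hw) ∈ locusAtInfinity g := by
  rw [mem_locusAtInfinity_iff g w hw, mem_projZeros_iff (formAtInfinity_isHomogeneous g)]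
  exact h

/-- A closed set not containing C yields a polynomial on V(x_0) that vanishes on the set but is not
divisible by F. As F is prime, two such polynomials are both nonzero at some point of C. -/
theorem isZariskiIrreducible_locusAtInfinity [IsAlgClosed k] {g : MvPolynomial (Fin 3) k}
    (hd : 2 ≤ g.totalDegree) (hirr : Irreducible (formAtInfinity g)) :
    IsZariskiIrreducible (locusAtInfinity g) := by
  have hF := formAtInfinity_isHomogeneous g
  constructor
  · obtain ⟨w, hw, hw'⟩ := exists_ne_zero_zero hd hF hirr
    exact ⟨_, mk_cons_zero_mem_locusAtInfinity hw hw'⟩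
  have hr : ∀ (P : MvPolynomial (Fin 4) k) (w : Fin 3 → k),
      eval w (aeval (Fin.cons 0 X : Fin 4 → MvPolynomial (Fin 3) k) P) =
        eval (Fin.cons 0 w : Fin 4 → k) P := by
    intro P w
    rw [eval_aeval_eq]
    congr 2
    funext j
    refine Fin.cases ?_ (fun j => ?_) j <;> simp
  have hsub : ∀ A : Set (ℙ k (Fin 4 → k)), IsZariskiClosed A → ¬ locusAtInfinity g ⊆ A →
      ∃ P : MvPolynomial (Fin 3) k, ¬ formAtInfinity g ∣ P ∧
        ∀ (w : Fin 3 → k) (hw : w ≠ 0),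
          Projectivization.mk k _ (cons_zero_ne_zero hw) ∈ A → eval w P = 0 := by
    rintro A ⟨S, hS, rfl⟩ hA
    obtain ⟨q, hq, hqA⟩ := Set.not_subset.1 hA
    simp only [Set.mem_iInter, not_forall] at hqA
    obtain ⟨P, hPS, hP⟩ := hqA
    obtain ⟨e, he⟩ := hS P hPS
    obtain ⟨w, hw, rfl, hw'⟩ := exists_eq_mk_of_mem_locusAtInfinity hq
    refine ⟨aeval (Fin.cons 0 X : Fin 4 → MvPolynomial (Fin 3) k) P, ?_, ?_⟩
    · rintro ⟨Q, hQ⟩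
      rw [mem_projZeros_iff he, ← hr, hQ, map_mul, hw', zero_mul] at hP
      exact hP rfl
    · intro w hw hwA
      rw [hr, ← mem_projZeros_iff he _ (cons_zero_ne_zero hw)]
      exact Set.mem_iInter₂.1 hwA P hPS
  intro A B hA hB hAB
  by_contra! hcon
  obtain ⟨P, hP, hPA⟩ := hsub A hA hcon.1
  obtain ⟨Q, hQ, hQB⟩ := hsub B hB hcon.2
  have hX : ¬ formAtInfinity g ∣ X 0 :=
    not_dvd_of_isHomogeneous_lt hirr.ne_zero hF (isHomogeneous_X k 0) (X_ne_zero 0) hd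
  -- The factor `X 0` excludes the origin, a zero of F that is no projective point.
  obtain ⟨w, hw, hw'⟩ := exists_zero_of_not_dvd hirr (P := X 0 * (P * Q)) fun h => by
    rcases hirr.prime.dvd_or_dvd h with h | h
    · exact hX h
    · exact (hirr.prime.dvd_or_dvd h).elim hP hQ
  have hw0 : w ≠ 0 := by
    rintro rfl
    simp at hw'
  rw [map_mul, map_mul] at hw'
  rcases hAB (mk_cons_zero_mem_locusAtInfinity hw0 hw) with h | h
  · simp [hPA w hw0 h] at hw'
  · simp [hQB w hw0 h] at hw'

theorem projZeros_homogenization_eq_cone {g : MvPolynomial (Fin 3) k}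
    (hne : (locusAtInfinity g).Nonempty) {a : Fin 3 → k}
    (h : ∀ x, eval (a + x) g = eval x (formAtInfinity g)) :
    ∃ v : ℙ k (Fin 4 → k), v ∉ hyperplaneAtInfinity k 3 ∧
      projZeros (homogenization g) = cone v (locusAtInfinity g) := by
  have hv0 : (Fin.cons 1 a : Fin 4 → k) ≠ 0 := fun h => by simpa using congrFun h 0
  refine ⟨Projectivization.mk k _ hv0, ?_, ?_⟩
  · rw [hyperplaneAtInfinity, mem_projZeros_iff (isHomogeneous_X k 0)]
    simp
  ext r
  induction r using Projectivization.ind with | h r hr =>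
  rw [mem_projZeros_iff (homogenization_isHomogeneous g)]
  have hr1 : r = r 0 • (Fin.cons 1 a : Fin 4 → k) +
      (Fin.cons 0 (Fin.tail r - r 0 • a) : Fin 4 → k) := by
    funext j
    refine Fin.cases ?_ (fun j => ?_) j <;> simp [Fin.tail]
  have hr2 := eval_homogenization_of_vertex h (r 0) (Fin.tail r)
  rw [Fin.cons_self_tail] at hr2
  rw [hr2]
  simp only [cone, Set.mem_ofPred_eq, Projectivization.submodule_mk,
    Submodule.span_singleton_le_iff_mem]
  constructor
  · intro hz
    by_cases hw : Fin.tail r - r 0 • a = 0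
    -- Here r is the vertex, which lies on every line of the cone; one point of C suffices.
    · obtain ⟨q, hq⟩ := hne
      refine ⟨q, hq, Submodule.mem_sup_left (Submodule.mem_span_singleton.2 ⟨r 0, ?_⟩)⟩
      conv_rhs => rw [hr1, hw]
      funext j
      refine Fin.cases ?_ (fun j => ?_) j <;> simp
    · refine ⟨_, mk_cons_zero_mem_locusAtInfinity hw hz, ?_⟩
      rw [Projectivization.submodule_mk, Submodule.mem_sup]
      exact ⟨_, Submodule.mem_span_singleton.2 ⟨r 0, rfl⟩, _,
        Submodule.mem_span_singleton_self _, hr1.symm⟩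
  · rintro ⟨q, hq, hrq⟩
    obtain ⟨w, hw, rfl, hw'⟩ := exists_eq_mk_of_mem_locusAtInfinity hq
    rw [Projectivization.submodule_mk, Submodule.mem_sup] at hrq
    obtain ⟨y, hy, z, hz, hyz⟩ := hrq
    obtain ⟨α, rfl⟩ := Submodule.mem_span_singleton.1 hy
    obtain ⟨β, rfl⟩ := Submodule.mem_span_singleton.1 hz
    have : Fin.tail r - r 0 • a = β • w := by
      rw [← hyz]
      funext j
      simp [Fin.tail]
    rw [this, eval_smul_of_isHomogeneous (formAtInfinity_isHomogeneous g), hw', mul_zero]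

end AtInfinity

/-! ### Multiplicities: forms versus affine charts. -/

section Multiplicity

variable {k : Type*} [Field k] [Infinite k]

theorem homogeneousComponent_translate_eq_zero_iff {σ : Type*} (F : MvPolynomial σ k)
    (p : σ → k) (j : ℕ) :
    homogeneousComponent j (translate F p) = 0 ↔ ∀ x, (lineP F p x).coeff j = 0 := by
  constructor
  · intro h x
    rw [coeff_lineP, h, map_zero]
  · intro h
    refine MvPolynomial.funext fun x => ?_
    rw [← coeff_lineP, h, map_zero]

/-- Exchanging point and direction moves c into the direction, where it only contributes a power of
c. -/
theorem homogeneousComponent_translate_smul_eq_zero_iff {σ : Type*} {F : MvPolynomial σ k}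
    {d : ℕ} (hF : F.IsHomogeneous d) {c : k} (hc : c ≠ 0) (p : σ → k) {j : ℕ} (hj : j ≤ d) :
    homogeneousComponent j (translate F (c • p)) = 0 ↔
      homogeneousComponent j (translate F p) = 0 := by
  simp only [homogeneousComponent_translate_eq_zero_iff]
  refine forall_congr' fun x => ?_
  rw [← coeff_lineP_comm hF x (c • p) hj, ← coeff_lineP_comm hF x p hj, coeff_lineP_smul]
  simp [hc]

/-- Expansion around a point in an affine chart is the restriction of the expansion around a
representative. -/
theorem homogeneousComponent_translate_dehomog {n : ℕ} (F : MvPolynomial (Fin (n + 1)) k)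
    (p : ℙ k (Fin (n + 1) → k)) (i : Fin (n + 1)) (hi : p.rep i ≠ 0) (j : ℕ) :
    homogeneousComponent j (translate (dehomog i F) (chart i p)) =
      aeval (Fin.insertNth i (C 0) X : Fin (n + 1) → MvPolynomial (Fin n) k)
        (homogeneousComponent j (translate F ((p.rep i)⁻¹ • p.rep))) := by
  refine MvPolynomial.funext fun y => ?_
  rw [eval_aeval_insertNth, ← coeff_lineP, ← coeff_lineP]
  congr 1
  refine poly_ext_of_eval_ne_zero fun t _ => ?_
  have h := eval_aeval_insertNth i 1 (chart i p + t • y) F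
  rw [C_1] at h
  rw [eval_lineP, eval_lineP, dehomog, h]
  congr 2
  funext l
  refine Fin.succAboveCases i ?_ (fun l => ?_) l <;> simp [chart, hi, div_eq_inv_mul]

/-- If the expansion around a vector `u` with `u i = 1` vanishes to order greater than `m` on the
hyperplane `x i = 0`, then the part of degree `m` vanishes. -/
theorem homogeneousComponent_translate_eq_zero_of_insertNth {n d m : ℕ}
    {F : MvPolynomial (Fin (n + 1)) k} (hF : F.IsHomogeneous d) {u : Fin (n + 1) → k}
    {i : Fin (n + 1)} (hu : u i = 1) (hm : m ≤ d)
    (h : ∀ j ≤ m, ∀ y : Fin n → k, (lineP F u (Fin.insertNth i 0 y)).coeff j = 0) :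
    homogeneousComponent m (translate F u) = 0 := by
  rw [homogeneousComponent_translate_eq_zero_iff]
  intro x
  set y : Fin n → k := fun l => x (i.succAbove l) - x i * u (i.succAbove l)
  set x' : Fin (n + 1) → k := Fin.insertNth i 0 y
  have hx : x = x' + x i • u := by
    funext l
    refine Fin.succAboveCases i ?_ (fun l => ?_) l <;> simp [x', y, hu]
  -- Adding a multiple of u to x' shifts the parameter of the line, which preserves degree; and
  -- degree < d - m says that the coefficients of F(u + T x') up to T^m vanish.
  have ht : lineP F x u = Polynomial.taylor (x i) (lineP F x' u) := by
    refine poly_ext_of_eval_ne_zero fun t _ => ?_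
    rw [Polynomial.taylor_eval, eval_lineP, eval_lineP]
    congr 2
    conv_lhs => rw [hx]
    rw [add_smul]
    abel
  have hdeg : (lineP F x' u).degree < ((d - m : ℕ) : WithBot ℕ) := by
    rw [Polynomial.degree_lt_iff_coeff_zero]
    intro e he
    by_cases hed : e ≤ d
    · have := coeff_lineP_comm hF x' u (j := d - e) (by omega)
      rw [Nat.sub_sub_self hed] at this
      rw [this]
      exact h _ (by omega) y
    · exact Polynomial.coeff_eq_zero_of_natDegree_lt
        (((natDegree_lineP_le _ _ _).trans hF.totalDegree_le).trans_lt (by omega))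
  rw [← Polynomial.degree_taylor _ (x i), ← ht] at hdeg
  rw [← coeff_lineP_comm hF x u hm]
  exact Polynomial.coeff_eq_zero_of_degree_lt hdeg

/-- The multiplicity of a projective hypersurface at a point can be read off from the expansion
of its form around a representative of the point. -/
theorem hasMult_of_homogeneousComponent {n d m : ℕ} {F : MvPolynomial (Fin (n + 1)) k}
    (hF : F.IsHomogeneous d) (hm : m ≤ d) (p : ℙ k (Fin (n + 1) → k))
    (h0 : ∀ j < m, homogeneousComponent j (translate F p.rep) = 0)
    (h1 : homogeneousComponent m (translate F p.rep) ≠ 0) : HasMult F p m := by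
  intro i hi
  have hc : (p.rep i)⁻¹ ≠ 0 := inv_ne_zero hi
  have h0' : ∀ j < m, homogeneousComponent j (translate (dehomog i F) (chart i p)) = 0 := by
    intro j hj
    rw [homogeneousComponent_translate_dehomog F p i hi,
      (homogeneousComponent_translate_smul_eq_zero_iff hF hc p.rep (by omega)).2 (h0 j hj),
      map_zero]
  refine ⟨h0', fun h2 => h1 ?_⟩
  rw [← homogeneousComponent_translate_smul_eq_zero_iff hF hc p.rep hm]
  refine homogeneousComponent_translate_eq_zero_of_insertNth hF (i := i) (by simp [hi]) hm
    fun j hj y => ?_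
  rw [coeff_lineP, ← eval_aeval_insertNth, ← homogeneousComponent_translate_dehomog F p i hi]
  rcases hj.lt_or_eq with hj | rfl
  · rw [h0' j hj, map_zero]
  · rw [h2, map_zero]

theorem exists_smul_eq_rep_mk {k : Type*} [Field k] {n : ℕ} {r : Fin n → k} (hr : r ≠ 0) :
    ∃ c : k, c ≠ 0 ∧ (Projectivization.mk k r hr).rep = c • r := by
  obtain ⟨a, ha⟩ := Projectivization.exists_smul_eq_mk_rep k r hr
  exact ⟨a, a.ne_zero, ha.symm⟩

end Multiplicity

/-! ### Cross products. -/

section CrossProduct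

open Matrix

variable {k : Type*} [Field k]

/-- The vectors n × b fill the plane orthogonal to n and are polynomial in n, so with n = ∇F(p)
tangent vectors become polynomial in p. -/
theorem exists_cross_eq {n x : Fin 3 → k} (hn : n ≠ 0) (h : ∑ i, n i * x i = 0) :
    ∃ b, n ⨯₃ b = x := by
  rw [Fin.sum_univ_three] at h
  have h' : n 0 ≠ 0 ∨ n 1 ≠ 0 ∨ n 2 ≠ 0 := by
    by_contra! hc
    exact hn (by ext i; fin_cases i <;> simp [hc])
  rcases h' with h' | h' | h'
  · refine ⟨![0, x 2 / n 0, -x 1 / n 0], ?_⟩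
    rw [cross_apply]
    ext i
    fin_cases i <;> simp <;> field_simp
    linear_combination -h
  · refine ⟨![-x 2 / n 1, 0, x 0 / n 1], ?_⟩
    rw [cross_apply]
    ext i
    fin_cases i <;> simp <;> field_simp
    linear_combination -h
  · refine ⟨![x 1 / n 2, -x 0 / n 2, 0], ?_⟩
    rw [cross_apply]
    ext i
    fin_cases i <;> simp <;> field_simp
    linear_combination -h

/-- Being orthogonal to p and a, n is a (possibly zero) multiple of p × a; expand the triple
product. -/
theorem cross_mem_span_of_orthogonal {p a n : Fin 3 → k} (hpa : LinearIndependent k ![p, a])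
    (hp : ∑ i, n i * p i = 0) (ha : ∑ i, n i * a i = 0) (b : Fin 3 → k) :
    ∃ α β : k, n ⨯₃ b = α • p + β • a := by
  have hw := crossProduct_ne_zero_iff_linearIndependent.2 hpa
  have h1 : (p ⨯₃ a) ⨯₃ n = 0 := by
    rw [cross_cross_eq_smul_sub_smul, dotProduct_comm p, dotProduct_comm a, dotProduct,
      dotProduct, hp, ha]
    simp
  have h2 : ¬ LinearIndependent k ![p ⨯₃ a, n] := fun h =>
    crossProduct_ne_zero_iff_linearIndependent.2 h h1
  rw [LinearIndependent.pair_iff' hw] at h2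
  push Not at h2
  obtain ⟨γ, rfl⟩ := h2
  refine ⟨-(γ * (a ⬝ᵥ b)), γ * (p ⬝ᵥ b), ?_⟩
  rw [map_smul, LinearMap.smul_apply, cross_cross_eq_smul_sub_smul]
  module

end CrossProduct

/-! ### Flexes. -/

section Flexes

open Matrix

variable {k : Type*} [Field k]

/-- The second order part of `F` at a point `p`, evaluated at the vector `∇F(p) × b` of the tangent
plane, as a polynomial in `p`. -/
def flexForm (F : MvPolynomial (Fin 3) k) (b : Fin 3 → k) : MvPolynomial (Fin 3) k :=
  (lineP F X ((fun i => pderiv i F) ⨯₃ (fun i => C (b i)))).coeff 2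

theorem eval_flexForm (F : MvPolynomial (Fin 3) k) (b p : Fin 3 → k) :
    eval p (flexForm F b) = (lineP F p ((fun i => eval p (pderiv i F)) ⨯₃ b)).coeff 2 := by
  rw [flexForm, eval_coeff_lineP]
  congr 2
  · simp
  · funext i
    rw [cross_apply, cross_apply]
    fin_cases i <;> simp

theorem homogeneousComponent_one_translate [Infinite k] (F : MvPolynomial (Fin 3) k)
    (u : Fin 3 → k) :
    homogeneousComponent 1 (translate F u) = linForm fun i => eval u (pderiv i F) :=
  MvPolynomial.funext fun x => by rw [← coeff_lineP, coeff_one_lineP, eval_linForm]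

/-- If F divided every flex form, the second-order part at each smooth point would vanish on all ∇F
× b, that is, on the tangent plane, and so be divisible by its equation. -/
theorem exists_flexForm_not_dvd [IsAlgClosed k] {F : MvPolynomial (Fin 3) k} {d : ℕ}
    (hF : F.IsHomogeneous d) (h : ¬ IsFlexy F) : ∃ b, ¬ F ∣ flexForm F b := by
  by_contra! hb
  refine h fun p hp i hi => ?_
  have hsm := (hp.2 i hi).2
  rw [homogeneousComponent_translate_dehomog F p i hi] at hsm ⊢
  rw [homogeneousComponent_translate_dehomog F p i hi]
  refine map_dvd _ ?_
  set u := (p.rep i)⁻¹ • p.rep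
  have hu : eval u F = 0 := by
    have : eval p.rep F = 0 := hp.1
    rw [eval_smul_of_isHomogeneous hF, this, mul_zero]
  rw [homogeneousComponent_one_translate] at hsm ⊢
  have hn : (fun i => eval u (pderiv i F)) ≠ 0 := by
    intro h0
    apply hsm
    rw [h0]
    simp [linForm]
  refine dvd_of_vanishes (irreducible_linForm hn) fun x hx => ?_
  rw [eval_linForm] at hx
  obtain ⟨b, rfl⟩ := exists_cross_eq hn hx
  obtain ⟨Q, hQ⟩ := hb b
  rw [← coeff_lineP, ← eval_flexForm, hQ, map_mul, hu, zero_mul]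

/-- If some line through `p ≠ 0` meets a curve of degree at least three only at `p`, then `p` is a
flex. -/
theorem eval_flexForm_eq_zero [IsAlgClosed k] {F : MvPolynomial (Fin 3) k} {d : ℕ} (hd : 3 ≤ d)
    (hF : F.IsHomogeneous d) {p a : Fin 3 → k} (hp : p ≠ 0) (hpF : eval p F = 0)
    (h : ∀ t : k, eval (a + t • p) F ≠ 0) (b : Fin 3 → k) : eval p (flexForm F b) = 0 := by
  have hind : LinearIndependent k ![p, a] := by
    rw [LinearIndependent.pair_iff' hp]
    rintro γ rfl
    have := h 0
    rw [zero_smul, add_zero, eval_smul_of_isHomogeneous hF, hpF, mul_zero] at this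
    exact this rfl
  have hpow : ∀ t : k, eval (t • p) F = 0 := fun t => by
    rw [eval_smul_of_isHomogeneous hF, hpF, mul_zero]
  obtain ⟨c, hc⟩ : ∃ c, ∀ t : k, eval (a + t • p) F = c := by
    obtain ⟨c, m, hcm⟩ := exists_eq_C_mul_X_pow (f := lineP F a p) fun t ht =>
      absurd (by rwa [eval_lineP] at ht) (h t)
    have hm : m = 0 := by
      by_contra hm
      apply h 0
      rw [← eval_lineP, hcm]
      simp [hm]
    refine ⟨c, fun t => ?_⟩
    rw [← eval_lineP, hcm, hm]
    simp
  have hplane : ∀ s t : k, eval (s • p + t • a) F = c * t ^ d := by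
    intro s t
    by_cases ht : t = 0
    · rw [ht, zero_smul, add_zero, hpow, zero_pow (by omega), mul_zero]
    · have : s • p + t • a = t • (a + (t⁻¹ * s) • p) := by
        rw [smul_add, smul_smul, mul_inv_cancel_left₀ ht, add_comm]
      rw [this, eval_smul_of_isHomogeneous hF, hc, mul_comm]
  have hline : ∀ α β : k, lineP F p (α • p + β • a) =
      Polynomial.C (c * β ^ d) * Polynomial.X ^ d := by
    intro α β
    refine poly_ext_of_eval_ne_zero fun t _ => ?_
    have : p + t • (α • p + β • a) = (1 + t * α) • p + (t * β) • a := by module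
    rw [eval_lineP, this, hplane]
    simp
    ring
  -- Since d ≥ 3, F(p + T y) has no terms in T or T² for y in the span of p and a; in particular
  -- ∇F(p) is orthogonal to that span.
  have hn : ∀ α β : k,
      ∑ i, eval p (pderiv i F) * (α • p + β • a) i = 0 := by
    intro α β
    rw [← coeff_one_lineP, hline, Polynomial.coeff_C_mul_X_pow, if_neg (by omega)]
  obtain ⟨α, β, hαβ⟩ := cross_mem_span_of_orthogonal hind (by simpa using hn 1 0)
    (by simpa using hn 0 1) b
  rw [eval_flexForm, hαβ, hline, Polynomial.coeff_C_mul_X_pow, if_neg (by omega)]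

end Flexes

/-! ### The point of multiplicity d - 1. -/

section SingularPoint

open Matrix

variable {k : Type*} [Field k] [IsAlgClosed k]

theorem exists_not_tangent {F : MvPolynomial (Fin 3) k} (h : ¬ IsFunny F) (q : Fin 3 → k)
    (hq : q ≠ 0) : ∃ p, eval p F = 0 ∧ (lineP F p q).coeff 1 ≠ 0 := by
  unfold IsFunny at h
  push Not at h
  obtain ⟨p, hp, -, hpq⟩ := h (Projectivization.mk k q hq)
  refine ⟨p.rep, hp, fun h0 => hpq ?_⟩
  obtain ⟨c, -, hc⟩ := exists_smul_eq_rep_mk hq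
  rw [JoinIsTangent, hc, ← coeff_one_lineP, coeff_lineP_smul, h0, mul_zero]

/-- If every point of a plane curve lies on a line meeting the curve elsewhere in a fixed finite
set only, then, unless the curve is flexy or funny, some point of the finite set has multiplicity
one less than the degree. -/
theorem exists_vanishing_to_order {F : MvPolynomial (Fin 3) k} {d : ℕ} (hd : 3 ≤ d)
    (hF : F.IsHomogeneous d) (hirr : Irreducible F) {s : ℕ} {r : Fin s → Fin 3 → k}
    (hr : ∀ v : Fin 3 → k, v ≠ 0 →
      ∃ a : Fin 3 → k, ∀ t : k, eval (a + t • v) F = 0 → a + t • v ∈ Set.range r)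
    (hflex : ¬ IsFlexy F) (hfun : ¬ IsFunny F) :
    ∃ j, r j ≠ 0 ∧ ∀ i < d - 1, homogeneousComponent i (translate F (r j)) = 0 := by
  by_contra! hcon
  obtain ⟨b, hb⟩ := exists_flexForm_not_dvd hF hflex
  obtain ⟨c, hc, hsep⟩ := exists_separating_forms r
  have hlin : ∀ c : Fin 3 → k, c ≠ 0 → ¬ F ∣ linForm c := fun c hc =>
    not_dvd_of_isHomogeneous_lt hirr.ne_zero hF (linForm_isHomogeneous c) (linForm_ne_zero hc)
      (by omega)
  have hX : ¬ F ∣ X 0 :=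
    not_dvd_of_isHomogeneous_lt hirr.ne_zero hF (isHomogeneous_X k 0) (X_ne_zero 0) (by omega)
  have hH : ∀ j, ∃ H : MvPolynomial (Fin 3) k, ¬ F ∣ H ∧ ∀ p, eval p F = 0 → eval p H ≠ 0 →
      ∃ t : k, eval (r j + t • p) F = 0 ∧ t ≠ 0 := by
    intro j
    by_cases hj : r j = 0
    -- The line through the origin in direction p lies in V(F), so t = 1 is a second zero.
    · refine ⟨1, fun h => hirr.not_isUnit (isUnit_of_dvd_one h), fun p hp _ => ⟨1, ?_, one_ne_zero⟩⟩
      rwa [hj, one_smul, zero_add]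
    · obtain ⟨i, hi, hi'⟩ := hcon j hj
      obtain ⟨q, hq, hq'⟩ := exists_not_tangent hfun (r j) hj
      rw [← coeff_lineP_comm hF (r j) q (by omega), coeff_lineP] at hq'
      refine ⟨homogeneousComponent (d - 1) (translate F (r j)) *
        homogeneousComponent i (translate F (r j)), fun h => ?_, fun p hp hpH => ?_⟩
      · rcases hirr.prime.dvd_or_dvd h with ⟨Q, hQ⟩ | h
        · rw [hQ, map_mul, hq, zero_mul] at hq'
          exact hq' rfl
        · exact not_dvd_of_isHomogeneous_lt hirr.ne_zero hF
            (homogeneousComponent_isHomogeneous _ _) hi' (by omega) h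
      · by_contra! hroot
        -- The restriction would be a monomial, yet its coefficients in degrees d - 1 and i < d - 1
        -- are both nonzero.
        obtain ⟨e, m, hem⟩ := exists_eq_C_mul_X_pow (f := lineP F (r j) p) fun t ht =>
          hroot t (by rwa [eval_lineP] at ht)
        rw [map_mul, ← coeff_lineP, ← coeff_lineP, hem, Polynomial.coeff_C_mul_X_pow,
          Polynomial.coeff_C_mul_X_pow] at hpH
        split_ifs at hpH
        · omega
        all_goals simp at hpH
  choose H hH hH' using hH
  obtain ⟨p, hp, hp'⟩ := exists_zero_of_not_dvd hirr
    (P := X 0 * flexForm F b * (∏ j, H j) * ∏ i, ∏ l, linForm (c i l)) fun h => by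
      rcases hirr.prime.dvd_or_dvd h with h | h
      · rcases hirr.prime.dvd_or_dvd h with h | h
        · exact (hirr.prime.dvd_or_dvd h).elim hX hb
        · obtain ⟨j, -, hj⟩ := hirr.prime.exists_mem_finset_dvd h
          exact hH j hj
      · obtain ⟨i, -, hi⟩ := hirr.prime.exists_mem_finset_dvd h
        obtain ⟨l, -, hl⟩ := hirr.prime.exists_mem_finset_dvd hi
        exact hlin _ (hc i l) hl
  rw [map_mul, map_mul, map_mul] at hp'
  have h1 := right_ne_zero_of_mul hp'
  have h2 := right_ne_zero_of_mul (left_ne_zero_of_mul hp')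
  have h3 := right_ne_zero_of_mul (left_ne_zero_of_mul (left_ne_zero_of_mul hp'))
  have h4 := left_ne_zero_of_mul (left_ne_zero_of_mul (left_ne_zero_of_mul hp'))
  have hp0 : p ≠ 0 := by
    rintro rfl
    simp at h4
  obtain ⟨a, ha⟩ := hr p hp0
  by_cases hroot : ∃ t : k, eval (a + t • p) F = 0
  · obtain ⟨t₀, ht₀⟩ := hroot
    obtain ⟨j, hj⟩ := ha t₀ ht₀
    rw [eval_prod, Finset.prod_ne_zero_iff] at h2
    obtain ⟨t, ht, ht'⟩ := hH' j p hp (h2 j (Finset.mem_univ _))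
    exact ht' (eq_zero_of_mem_line (hsep p h1) ha hj t ht)
  · push Not at hroot
    exact h3 (eval_flexForm_eq_zero hd hF hp0 hp hroot b)

theorem not_dvd_of_isHomogeneous_irreducible {k : Type*} [Field k]
    {F P : MvPolynomial (Fin 3) k} {d e : ℕ}
    (hF : F.IsHomogeneous d) (hirr : Irreducible F) (hP : P.IsHomogeneous e)
    (hPirr : Irreducible P) (h : e < d) : ¬ P ∣ F := fun hd =>
  not_dvd_of_isHomogeneous_lt hirr.ne_zero hF hP hPirr.ne_zero h
    (hPirr.dvd_symm hirr hd)

/-- A point of multiplicity `d - 1` is the only singular point of an irreducible plane curve of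
degree `d`. -/
theorem exists_unique_singularPt {F : MvPolynomial (Fin 3) k} {d : ℕ} (hd : 3 ≤ d)
    (hF : F.IsHomogeneous d) (hirr : Irreducible F) {r : Fin 3 → k} (hr : r ≠ 0)
    (h : ∀ i < d - 1, homogeneousComponent i (translate F r) = 0)
    (h1 : homogeneousComponent (d - 1) (translate F r) ≠ 0) :
    ∃ q : ℙ k (Fin 3 → k), IsSingularPt F q ∧
      (∀ q' : ℙ k (Fin 3 → k), IsSingularPt F q' → q' = q) ∧ HasMult F q (d - 1) := by
  obtain ⟨c, hc, hrep⟩ := exists_smul_eq_rep_mk hr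
  have hmult : HasMult F (Projectivization.mk k r hr) (d - 1) := by
    refine hasMult_of_homogeneousComponent hF (by omega) _ (fun j hj => ?_) ?_
    · rw [hrep, homogeneousComponent_translate_smul_eq_zero_iff hF hc r (by omega)]
      exact h j hj
    · rwa [hrep, Ne, homogeneousComponent_translate_smul_eq_zero_iff hF hc r (by omega)]
  refine ⟨Projectivization.mk k r hr, ⟨?_, fun h1' => ?_⟩, fun q' hq' => ?_, hmult⟩
  · rw [mem_projZeros_iff hF, ← coeff_zero_lineP F r 0, coeff_lineP, h 0 (by omega), map_zero]
  · obtain ⟨i, hi⟩ := Function.ne_iff.1 (Projectivization.mk k r hr).rep_nonzero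
    exact (h1' i hi).2 ((hmult i hi).1 1 (by omega))
  · by_contra hne
    have hy : eval q'.rep F = 0 := hq'.1
    set y := q'.rep with hydef
    have hy1 : homogeneousComponent 1 (translate F y) = 0 := by
      by_contra h'
      refine hq'.2 (hasMult_of_homogeneousComponent hF (by omega) q' (fun j hj => ?_) h')
      obtain rfl : j = 0 := by omega
      rw [homogeneousComponent_translate_eq_zero_iff]
      intro x
      rw [coeff_zero_lineP]
      exact hy
    -- Coefficients below T^(d-1) vanish by the multiplicity at r, that of T^(d-1) is ∇F(y)·r by
    -- polarity, and that of T^d is F(y).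
    have hline : lineP F r y = 0 := by
      ext j
      rw [Polynomial.coeff_zero]
      rcases lt_trichotomy j (d - 1) with hj | rfl | hj
      · rw [coeff_lineP, h j hj, map_zero]
      · rw [coeff_lineP_comm hF r y (by omega), coeff_lineP, hy1, map_zero]
      · rcases (show d ≤ j by omega).eq_or_lt with rfl | hj
        · rw [coeff_natDegree_lineP hF, hy]
        · exact Polynomial.coeff_eq_zero_of_natDegree_lt
            (((natDegree_lineP_le _ _ _).trans hF.totalDegree_le).trans_lt hj)
    have hplane : ∀ s t : k, eval (s • r + t • y) F = 0 := by
      intro s t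
      by_cases hs : s = 0
      · rw [hs, zero_smul, zero_add, eval_smul_of_isHomogeneous hF, hy, mul_zero]
      · have : s • r + t • y = s • (r + (s⁻¹ * t) • y) := by
          rw [smul_add, smul_smul, mul_inv_cancel_left₀ hs]
        rw [this, eval_smul_of_isHomogeneous hF, ← eval_lineP, hline, Polynomial.eval_zero,
          mul_zero]
    have hind : LinearIndependent k ![r, y] := by
      rw [LinearIndependent.pair_iff' hr]
      intro γ hγ
      apply hne
      rw [← q'.mk_rep, Projectivization.mk_eq_mk_iff']
      exact ⟨γ, hγ⟩
    -- The plane orthogonal to r × y is the span of r and y, on which F vanishes, so its linear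
    -- equation would divide F.
    have hw := crossProduct_ne_zero_iff_linearIndependent.2 hind
    refine not_dvd_of_isHomogeneous_irreducible hF hirr (linForm_isHomogeneous _)
      (irreducible_linForm hw) (by omega) (dvd_of_vanishes (irreducible_linForm hw) fun x hx => ?_)
    rw [eval_linForm] at hx
    obtain ⟨b, rfl⟩ := exists_cross_eq hw hx
    rw [cross_cross_eq_smul_sub_smul, sub_eq_neg_add, ← neg_smul]
    exact hplane _ _

end SingularPoint

end

end KakeyaCone

theorem mainTheorem2 {k : Type*} [Field k] [IsAlgClosed k]
    (g : MvPolynomial (Fin 3) k) (hg : Irreducible g)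
    (d : ℕ) (hd : 3 ≤ d) (hgd : g.totalDegree = d)
    (s : ℕ) (R : Fin s → (Fin 3 → k)) (hR : ∀ i, MvPolynomial.eval (R i) g = 0)
    (hE : KakeyaCone.IsKakeya (Set.range R ∪ {x | MvPolynomial.eval x g ≠ 0})) :
    (KakeyaCone.IsZariskiIrreducible (KakeyaCone.locusAtInfinity g) ∧
      Irreducible (KakeyaCone.formAtInfinity g)) ∧
    (∃ v : ℙ k (Fin 4 → k), v ∉ KakeyaCone.hyperplaneAtInfinity k 3 ∧
      KakeyaCone.projZeros (KakeyaCone.homogenization g) =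
        KakeyaCone.cone v (KakeyaCone.locusAtInfinity g)) ∧
    (¬ KakeyaCone.IsFlexy (KakeyaCone.formAtInfinity g) →
      ¬ KakeyaCone.IsFunny (KakeyaCone.formAtInfinity g) →
      ∃ q : ℙ k (Fin 3 → k),
        KakeyaCone.IsSingularPt (KakeyaCone.formAtInfinity g) q ∧
        (∀ q' : ℙ k (Fin 3 → k),
          KakeyaCone.IsSingularPt (KakeyaCone.formAtInfinity g) q' → q' = q) ∧
        KakeyaCone.HasMult (KakeyaCone.formAtInfinity g) q (d - 1)) := by
  open KakeyaCone in
  subst hgd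
  obtain ⟨i₀, hv⟩ := exists_vertex (by omega) hE
  have hF := formAtInfinity_isHomogeneous g
  have hirr := irreducible_of_forall_eval_add hg _ hv
  have hZ := isZariskiIrreducible_locusAtInfinity (by omega) hirr
  refine ⟨⟨hZ, hirr⟩, projZeros_homogenization_eq_cone hZ.1 hv, fun hflex hfun => ?_⟩
  -- Translating the vertex to the origin turns the Kakeya lines for g into lines for F.
  obtain ⟨j, hj, hj'⟩ := exists_vanishing_to_order (r := fun j => R j - R i₀) hd hF hirr
    (fun v hv0 => by
      obtain ⟨a, ha⟩ := hE.exists_line v hv0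
      refine ⟨a - R i₀, fun t ht => ?_⟩
      have h1 : R i₀ + (a - R i₀ + t • v) = a + t • v := by abel
      rw [← hv, h1] at ht
      obtain ⟨l, hl⟩ := ha t ht
      refine ⟨l, ?_⟩
      show R l - R i₀ = _
      rw [hl]
      abel) hflex hfun
  -- By polarity, vanishing of the part of degree d - 1 would make every join with this point
  -- tangent, so C would be funny.
  refine exists_unique_singularPt hd hF hirr hj hj' fun h0 => ?_
  obtain ⟨p, -, hp⟩ := exists_not_tangent hfun _ hj
  rw [← coeff_lineP_comm hF _ p (by omega), coeff_lineP, h0, map_zero] at hp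
  exact hp rfl
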